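/- Let $D,m\ge 1$ and $n_1,\dots,n_D\ge 1$ be integers. Equip $\mathbb R^{n_1\times\cdots\times n_D}$ with the scalar product $\langle \mathcal X,\mathcal Y\rangle=\sum_{i_1,\dots,i_D}\mathcal X_{i_1,\dots,i_D}\,\mathcal Y_{i_1,\dots,i_D}$, the Frobenius norm $\|\mathcal X\|_F=\sqrt{\langle \mathcal X,\mathcal X\rangle}$, the spectral norm $$\|\mathcal X\|=\max\bigl\{\langle \mathcal X,u^{(1)}\otimes\cdots\otimes u^{(D)}\rangle:\ u^{(d)}\in\mathbb R^{n_d},\ \|u^{(d)}\|_2=1,\ d=1,\dots,D\bigr\},$$ and the nuclear norm $$\|\mathcal X\|_*=\max\bigl\{\langle \mathcal X,\mathcal Y\rangle:\ \mathcal Y\in\mathbb R^{n_1\times\cdots\times n_D},\ \|\mathcal Y\|\le 1\bigr\}.$$ Let $\mathcal G_1,\dots,\mathcal G_m$ be independent random tensors in $\mathbb R^{n_1\times\cdots\times n_D}$, each with independent $\mathcal N(0,1)$ entries, let $\mathcal X^\sharp\in\mathbb R^{n_1\times\cdots\times n_D}$ be a fixed tensor, and let $y_i=\langle \mathcal G_i,\mathcal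 X^\sharp\rangle$ for $i=1,\dots,m$. Let $\hat{\mathcal X}$ be a random tensor which is almost surely a solution of the convex program $$\min_{\mathcal X\in\mathbb R^{n_1\times\cdots\times n_D}}\|\mathcal X\|_*\quad\text{subject to}\quad \langle \mathcal G_i,\mathcal X\rangle=y_i,\quad i=1,\dots,m.$$ Then $\|\hat{\mathcal X}-\mathcal X^\sharp\|_F$ is integrable and $$\mathbb E\,\bigl\|\hat{\mathcal X}-\mathcal X^\sharp\bigr\|_F\ \le\ 4\sqrt{\pi}\ \frac{\sqrt{n_1}+\cdots+\sqrt{n_D}}{\sqrt m}\ \|\mathcal X^\sharp\|_*.$$ -/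

import Mathlib

open MeasureTheory ProbabilityTheory

noncomputable section

/-- Real tensors of format `n 0 × ⋯ × n (D - 1)`. The Euclidean inner product
`inner ℝ X Y = ∑ i, X i * Y i` is the scalar product of tensors and the Euclidean norm
`‖X‖ = √(∑ i, X i ^ 2)` is the Frobenius norm. -/
abbrev RealTensor {D : ℕ} (n : Fin D → ℕ) : Type :=
  EuclideanSpace ℝ ((d : Fin D) → Fin (n d))

/-- The elementary tensor `u 0 ⊗ ⋯ ⊗ u (D - 1)`. -/
def RealTensor.elementary {D : ℕ} {n : Fin D → ℕ}
    (u : (d : Fin D) → EuclideanSpace ℝ (Fin (n d))) : RealTensor n :=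
  WithLp.toLp 2 (fun i => ∏ d, u d (i d))

/-- The spectral (operator) norm: the maximum of `⟨X, u 0 ⊗ ⋯ ⊗ u (D - 1)⟩` over
Euclidean unit vectors `u d`. -/
def RealTensor.spectralNorm {D : ℕ} {n : Fin D → ℕ} (X : RealTensor n) : ℝ :=
  sSup {r : ℝ | ∃ u : (d : Fin D) → EuclideanSpace ℝ (Fin (n d)),
    (∀ d, ‖u d‖ = 1) ∧ r = inner ℝ X (RealTensor.elementary u)}

/-- The nuclear norm: the maximum of `⟨X, Y⟩` over tensors `Y` of spectral norm at most one. -/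
def RealTensor.nuclearNorm {D : ℕ} {n : Fin D → ℕ} (X : RealTensor n) : ℝ :=
  sSup {r : ℝ | ∃ Y : RealTensor n, RealTensor.spectralNorm Y ≤ 1 ∧ r = inner ℝ X Y}

/-- `X` solves: minimise the nuclear norm subject to `⟨G i, X⟩ = y i` for all `i`. -/
def RealTensor.IsNuclearNormSolution {D : ℕ} {n : Fin D → ℕ} {m : ℕ}
    (G : Fin m → RealTensor n) (y : Fin m → ℝ) (X : RealTensor n) : Prop :=
  (∀ i, inner ℝ (G i) X = y i) ∧
    ∀ X' : RealTensor n, (∀ i, inner ℝ (G i) X' = y i) →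
      RealTensor.nuclearNorm X ≤ RealTensor.nuclearNorm X'

/-- A random tensor with independent `N(0, 1)` entries. -/
structure RealTensor.IsStdGaussian {D : ℕ} {n : Fin D → ℕ} {Ω : Type*} [MeasurableSpace Ω]
    (G : Ω → RealTensor n) (P : Measure Ω) : Prop where
  hasLaw_entry : ∀ j, HasLaw (fun ω => G ω j) (gaussianReal 0 1) P
  indep_entries : iIndepFun (fun j ω => G ω j) P

end

/-! The error `h = Xhat - Xsharp` is orthogonal to every `G k`. Minimality of the nuclear norm and
the triangle inequality put it in `T`, the nuclear-norm ball of radius `R = 2‖Xsharp‖_*`. The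
theorem is then an M*-type bound on the section of `T` by a random kernel.

With `c = √(2/π)`, each `|⟨g, u⟩|` has mean `c‖u‖`. On the kernel, `m c ‖h‖ = ∑ k, (c‖h‖ - |⟨G k,
h⟩|)`, which is at most the supremum over `u ∈ T` of the same expression. Symmetrization and
contraction (`integral_iSup_sum_sub_abs_inner_le`) bound its mean by `2 E sup ⟨∑ k, G k, u⟩`. By
duality and Gaussian stability this is at most `2 R √m E‖g‖`, with `‖g‖` the spectral norm.

Finally `E‖g‖ ≤ ∑ d, √(n d)`: the process indexed by elementary unit tensors has smaller increments
than `∑ d, ⟨g_d, u_d⟩`, so Sudakov-Fernique (`integral_iSup_inner_le`) applies. Suprema are taken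
over finite nets, whose mesh tends to zero at the end. -/

section StdGaussian

/-! ### Standard Gaussian measure: density, integration by parts, moments, stability. -/

variable {E : Type*} [NormedAddCommGroup E] [InnerProductSpace ℝ E] [FiniteDimensional ℝ E]
  [MeasurableSpace E] [BorelSpace E]

/-- The standard Gaussian measure has density proportional to `exp (-‖x‖² / 2)`. -/
theorem stdGaussian_eq_withDensity :
    stdGaussian E = volume.withDensity (fun x : E => ENNReal.ofReal
      ((∫ y : E, Real.exp (-(1 / 2) * ‖y‖ ^ 2))⁻¹ * Real.exp (-(1 / 2) * ‖x‖ ^ 2))) := by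
  have hb : (0 : ℝ) < ((1 / 2 : ℝ) : ℂ).re := by norm_num
  set Z : ℝ := ∫ y : E, Real.exp (-(1 / 2) * ‖y‖ ^ 2) with hZ
  have hZpos : 0 < Z := by
    rw [hZ, GaussianFourier.integral_rexp_neg_mul_sq_norm (by norm_num)]
    positivity
  have hZC : (Z : ℂ) = (Real.pi / (1 / 2 : ℝ) : ℂ) ^ (Module.finrank ℝ E / 2 : ℂ) := by
    rw [hZ, ← GaussianFourier.integral_cexp_neg_mul_sq_norm (V := E) hb, ← integral_complex_ofReal]
    simp
  have hint : Integrable (fun x : E => Real.exp (-(1 / 2) * ‖x‖ ^ 2)) := by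
    have := (GaussianFourier.integrable_cexp_neg_mul_sq_norm_add (V := E) hb 0 0).norm
    refine this.congr (ae_of_all _ fun x => ?_)
    simp [Complex.norm_exp, ← Complex.ofReal_pow]
  have hfin : IsFiniteMeasure (volume.withDensity (fun x : E => ENNReal.ofReal
      (Z⁻¹ * Real.exp (-(1 / 2) * ‖x‖ ^ 2)))) :=
    isFiniteMeasure_withDensity_ofReal (hint.const_mul Z⁻¹).hasFiniteIntegral
  apply Measure.ext_of_charFun
  ext t
  rw [charFun_stdGaussian, charFun_apply,
    integral_withDensity_eq_integral_toReal_smul (by fun_prop) (by simp)]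
  have h1 : ∀ x : E, (ENNReal.ofReal (Z⁻¹ * Real.exp (-(1 / 2) * ‖x‖ ^ 2))).toReal •
      Complex.exp ((inner ℝ x t : ℝ) * Complex.I) =
      (Z : ℂ)⁻¹ * Complex.exp (-((1 / 2 : ℝ) : ℂ) * ‖x‖ ^ 2 +
        Complex.I * (inner ℝ t x : ℝ)) := by
    intro x
    rw [ENNReal.toReal_ofReal (by positivity), Complex.real_smul, Complex.exp_add,
      real_inner_comm, mul_comm Complex.I]
    push_cast
    ring
  simp_rw [h1]
  rw [integral_const_mul, GaussianFourier.integral_cexp_neg_mul_sq_norm_add hb, ← hZC,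
    inv_mul_cancel_left₀ (by exact_mod_cast hZpos.ne')]
  congr 1
  simp
  ring

theorem integrable_norm_stdGaussian : Integrable (fun w : E => ‖w‖) (stdGaussian E) :=
  (IsGaussian.integrable_id (μ := stdGaussian E)).norm

theorem integrable_inner_stdGaussian (v : E) :
    Integrable (fun w : E => inner ℝ w v) (stdGaussian E) :=
  (integrable_norm_stdGaussian.mul_const ‖v‖).mono' (by fun_prop)
    (ae_of_all _ fun w => norm_inner_le_norm w v)

/-- Gaussian integration by parts. -/
theorem integral_inner_mul_stdGaussian {ψ : E → ℝ} (hψ : ContDiff ℝ 1 ψ) (v : E) {C C' : ℝ}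
    (hC : ∀ w, |ψ w| ≤ C) (hC' : ∀ w, |fderiv ℝ ψ w v| ≤ C') :
    ∫ w, inner ℝ w v * ψ w ∂(stdGaussian E) = ∫ w, fderiv ℝ ψ w v ∂(stdGaussian E) := by
  have hdiff : Differentiable ℝ ψ := hψ.differentiable (by norm_num)
  have hcont' : Continuous fun w => fderiv ℝ ψ w v :=
    (hψ.continuous_fderiv (by norm_num)).clm_apply continuous_const
  have i1 : Integrable (fun w => inner ℝ w v * ψ w) (stdGaussian E) :=
    (integrable_inner_stdGaussian v).mul_bdd (c := C) hψ.continuous.aestronglyMeasurable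
      (ae_of_all _ hC)
  have i2 : Integrable (fun w => fderiv ℝ ψ w v) (stdGaussian E) :=
    (integrable_const C').mono' hcont'.aestronglyMeasurable (ae_of_all _ hC')
  have i3 : Integrable ψ (stdGaussian E) :=
    (integrable_const C).mono' hψ.continuous.aestronglyMeasurable (ae_of_all _ hC)
  set ρ : E → ℝ := fun x => (∫ y : E, Real.exp (-(1 / 2) * ‖y‖ ^ 2))⁻¹ *
    Real.exp (-(1 / 2) * ‖x‖ ^ 2) with hρ
  have hρ0 : ∀ x, 0 ≤ ρ x := fun x => mul_nonneg (inv_nonneg.2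
    (integral_nonneg fun y => (Real.exp_pos _).le)) (Real.exp_pos _).le
  have hρd : ∀ x, HasFDerivAt ρ (-(ρ x) • innerSL ℝ x) x := by
    intro x
    have h1 := ((hasStrictFDerivAt_norm_sq x).hasFDerivAt.const_mul (-(1 / 2 : ℝ))).exp.const_mul
      (∫ y : E, Real.exp (-(1 / 2) * ‖y‖ ^ 2))⁻¹
    convert! h1 using 1
    ext y
    simp [hρ]
    ring
  have hmeas : Measurable fun x => ENNReal.ofReal (ρ x) := by
    simp only [hρ]; fun_prop
  have key : ∀ f : E → ℝ, ∫ w, f w ∂(stdGaussian E) = ∫ w, f w * ρ w := by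
    intro f
    rw [stdGaussian_eq_withDensity, integral_withDensity_eq_integral_toReal_smul hmeas (by simp)]
    refine integral_congr_ae (ae_of_all _ fun x => ?_)
    simp only [smul_eq_mul]
    rw [ENNReal.toReal_ofReal (hρ0 x), mul_comm]
  have keyi : ∀ f : E → ℝ, Integrable f (stdGaussian E) → Integrable (fun w => f w * ρ w) := by
    intro f hf
    rw [stdGaussian_eq_withDensity,
      integrable_withDensity_iff_integrable_smul' hmeas (by simp)] at hf
    refine hf.congr (ae_of_all _ fun x => ?_)
    simp only [smul_eq_mul]
    rw [ENNReal.toReal_ofReal (hρ0 x), mul_comm]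
  rw [key, key]
  -- Since `∂_v ρ = -⟨w, v⟩ ρ`, Lebesgue integration by parts against the density `ρ` is the
  -- Gaussian formula.
  have := integral_mul_fderiv_eq_neg_fderiv_mul_of_integrable (μ := (volume : Measure E))
    (f := ψ) (g := ρ) (v := v) (keyi _ i2) ?_ (keyi _ i3) (fun x _ => hdiff x)
    (fun x _ => (hρd x).differentiableAt)
  · rw [← neg_eq_iff_eq_neg, ← integral_neg] at this
    rw [← this]
    refine integral_congr_ae (ae_of_all _ fun x => ?_)
    simp only [(hρd x).fderiv]
    simp
    ring
  · refine (keyi _ i1).neg.congr (ae_of_all _ fun x => ?_)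
    simp only [(hρd x).fderiv]
    simp
    ring

theorem integral_abs_gaussianReal : ∫ x, |x| ∂(gaussianReal 0 1) = √(2 / Real.pi) := by
  rw [integral_gaussianReal_eq_integral_smul (by norm_num)]
  have h := integral_comp_abs (f := fun x : ℝ => gaussianPDFReal 0 1 x * x)
  have h2 : ∫ x in Set.Ioi (0 : ℝ), x * Real.exp (-(1 / 2) * x ^ 2) = 1 := by
    have := integral_mul_cexp_neg_mul_sq (b := ((1 / 2 : ℝ) : ℂ)) (by norm_num)
    rw [← Complex.ofReal_inj, ← integral_complex_ofReal]
    simpa using this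
  have h3 : ∫ x in Set.Ioi (0 : ℝ), gaussianPDFReal 0 1 x * x = (√(2 * Real.pi))⁻¹ := by
    rw [← mul_one (√(2 * Real.pi))⁻¹, ← h2, ← integral_const_mul]
    refine integral_congr_ae (ae_of_all _ fun x => ?_)
    simp only [gaussianPDFReal]
    simp
    ring_nf
  have h4 : ∫ x, gaussianPDFReal 0 1 x • |x| = 2 * (√(2 * Real.pi))⁻¹ := by
    rw [← h3, ← h]
    refine integral_congr_ae (ae_of_all _ fun x => ?_)
    simp [gaussianPDFReal]
  rw [h4, Real.sqrt_mul (by norm_num), Real.sqrt_div (by norm_num)]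
  have : √(2 : ℝ) * √2 = 2 := Real.mul_self_sqrt (by norm_num)
  field_simp
  linarith

theorem map_inner_stdGaussian {v : E} :
    (stdGaussian E).map (fun w => inner ℝ w v) = (gaussianReal 0 1).map (fun x => ‖v‖ * x) := by
  have : (fun w : E => inner ℝ w v) = innerSL ℝ v := by
    ext w; simp [real_inner_comm]
  rw [this, IsGaussian.map_eq_gaussianReal, integral_strongDual_stdGaussian,
    variance_dual_stdGaussian, gaussianReal_map_const_mul]
  congr 1
  · simp
  · ext; simp

/-- The mean absolute value of a linear functional under the standard Gaussian measure. -/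
theorem integral_abs_inner_stdGaussian (v : E) :
    ∫ w, |inner ℝ w v| ∂(stdGaussian E) = √(2 / Real.pi) * ‖v‖ := by
  rw [← integral_map (φ := fun w : E => inner ℝ w v) (f := fun x : ℝ => |x|) (by fun_prop)
    (by fun_prop), map_inner_stdGaussian, integral_map (by fun_prop) (by fun_prop)]
  simp_rw [abs_mul]
  rw [integral_const_mul, integral_abs_gaussianReal, abs_norm, mul_comm]

theorem integral_inner_sq_stdGaussian (v : E) :
    ∫ w, inner ℝ w v ^ 2 ∂(stdGaussian E) = ‖v‖ ^ 2 := by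
  rw [← integral_map (φ := fun w : E => inner ℝ w v) (f := fun x : ℝ => x ^ 2) (by fun_prop)
    (by fun_prop), map_inner_stdGaussian, integral_map (by fun_prop) (by fun_prop)]
  simp_rw [mul_pow]
  rw [integral_const_mul]
  have h := variance_fun_id_gaussianReal (μ := 0) (v := 1)
  rw [variance_eq_integral (by fun_prop)] at h
  simp at h
  rw [h, mul_one]

theorem map_neg_stdGaussian : (stdGaussian E).map (fun w => -w) = stdGaussian E :=
  stdGaussian_map (LinearIsometryEquiv.neg ℝ)

/-- The coisometric image of a standard Gaussian vector is standard Gaussian. -/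
theorem map_stdGaussian_of_inner_eq {F : Type*} [NormedAddCommGroup F] [InnerProductSpace ℝ F]
    [FiniteDimensional ℝ F] [MeasurableSpace F] [BorelSpace F] {L : E →L[ℝ] F} {J : F → E}
    (hLJ : ∀ w t, inner ℝ (L w) t = inner ℝ w (J t)) (hJ : ∀ t, ‖J t‖ = ‖t‖) :
    (stdGaussian E).map L = stdGaussian F := by
  apply Measure.ext_of_charFun
  ext t
  rw [charFun_stdGaussian, ← hJ, ← charFun_stdGaussian, charFun_apply, charFun_apply,
    integral_map (by fun_prop) (by fun_prop)]
  simp_rw [hLJ]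

/-- The sum of `m` independent standard Gaussian vectors is `√m` times a standard Gaussian. -/
theorem map_sum_pi_stdGaussian (m : ℕ) :
    (Measure.pi fun _ : Fin m => stdGaussian E).map (fun a => ∑ i, a i) =
      (stdGaussian E).map (fun w => √(m : ℝ) • w) := by
  apply Measure.ext_of_charFun
  ext t
  rw [charFun_map_smul, charFun_stdGaussian, charFun_apply,
    integral_map (by fun_prop) (by fun_prop)]
  simp_rw [sum_inner, Complex.ofReal_sum, Finset.sum_mul, Complex.exp_sum]
  rw [integral_fintype_prod_eq_prod (f := fun _ (x : E) =>
    Complex.exp ((inner ℝ x t : ℝ) * Complex.I))]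
  simp_rw [← charFun_apply, charFun_stdGaussian]
  have h : ((‖√(m : ℝ) • t‖ : ℝ) : ℂ) ^ 2 = m * (‖t‖ : ℂ) ^ 2 := by
    have : ‖√(m : ℝ) • t‖ ^ 2 = m * ‖t‖ ^ 2 := by
      rw [norm_smul, mul_pow, Real.norm_eq_abs, sq_abs, Real.sq_sqrt (by positivity)]
    exact_mod_cast this
  rw [Finset.prod_const, ← Complex.exp_nat_mul, Finset.card_univ, Fintype.card_fin, h]
  congr 1
  ring

end StdGaussian

/-! ### Log-sum-exp as a smooth maximum, and its Gibbs weights. -/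

section Softmax

variable {E : Type*} [NormedAddCommGroup E] [InnerProductSpace ℝ E]
  {I : Type*} [Fintype I]

/-- Together with `log_sum_exp_le`, this traps log-sum-exp between the maximum and the maximum plus
`log (card I)`, an error that vanishes after rescaling. -/
theorem le_log_sum_exp (f : I → ℝ) (i : I) : f i ≤ Real.log (∑ j, Real.exp (f j)) := by
  rw [← Real.log_exp (f i)]
  exact Real.log_le_log (Real.exp_pos _)
    (Finset.single_le_sum (f := fun j => Real.exp (f j)) (fun j _ => (Real.exp_pos _).le)
      (Finset.mem_univ i))

/-- The variance of a probability vector against a symmetric kernel of negative type. -/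
theorem sum_mul_sub_sum_nonneg {p : I → ℝ} (hp : ∀ i, 0 ≤ p i) (hp1 : ∑ i, p i = 1)
    {K : I → I → ℝ} (hK : ∀ i j, K i j + K j i ≤ K i i + K j j) :
    0 ≤ ∑ i, p i * (K i i - ∑ j, p j * K i j) := by
  -- Symmetrizing in `i` and `j` turns the expression into a weighted double sum of terms that `hK`
  -- makes nonnegative.
  have h : ∑ i, p i * (K i i - ∑ j, p j * K i j) =
      (1 / 2) * ∑ i, ∑ j, p i * p j * (K i i + K j j - (K i j + K j i)) := by
    have e1 : ∑ i, ∑ j, p i * p j * K i i = ∑ i, p i * K i i := by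
      refine Finset.sum_congr rfl fun i _ => ?_
      simp_rw [mul_right_comm (p i) _ (K i i)]
      rw [← Finset.mul_sum, hp1, mul_one]
    have e2 : ∑ i, ∑ j, p i * p j * K j j = ∑ i, p i * K i i := by
      rw [Finset.sum_comm, ← e1]
      simp_rw [mul_comm (p _) (p _)]
    have e3 : ∑ i, ∑ j, p i * p j * K j i = ∑ i, ∑ j, p i * p j * K i j := by
      rw [Finset.sum_comm]
      simp_rw [mul_comm (p _) (p _)]
    simp_rw [mul_sub, mul_add, Finset.sum_sub_distrib, Finset.sum_add_distrib]
    rw [e1, e2, e3]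
    simp_rw [Finset.mul_sum, mul_assoc]
    ring
  rw [h]
  refine mul_nonneg (by norm_num) (Finset.sum_nonneg fun i _ => Finset.sum_nonneg fun j _ => ?_)
  exact mul_nonneg (mul_nonneg (hp i) (hp j)) (sub_nonneg.2 (hK i j))

variable [Nonempty I]

theorem sum_exp_pos (f : I → ℝ) : 0 < ∑ i, Real.exp (f i) :=
  Finset.sum_pos (fun _ _ => Real.exp_pos _) Finset.univ_nonempty

/-- The weights of the Gibbs measure with energies `⟨w, z i⟩`. -/
noncomputable def gibbsWeight (z : I → E) (i : I) (w : E) : ℝ :=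
  Real.exp (inner ℝ w (z i)) / ∑ j, Real.exp (inner ℝ w (z j))

theorem gibbsWeight_nonneg (z : I → E) (i : I) (w : E) : 0 ≤ gibbsWeight z i w :=
  div_nonneg (Real.exp_pos _).le (sum_exp_pos _).le

theorem sum_gibbsWeight (z : I → E) (w : E) : ∑ i, gibbsWeight z i w = 1 := by
  simp_rw [gibbsWeight, ← Finset.sum_div]
  exact div_self (sum_exp_pos _).ne'

theorem gibbsWeight_le_one (z : I → E) (i : I) (w : E) : gibbsWeight z i w ≤ 1 := by
  rw [← sum_gibbsWeight z w]
  exact Finset.single_le_sum (fun j _ => gibbsWeight_nonneg z j w) (Finset.mem_univ i)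

theorem contDiff_gibbsWeight (z : I → E) (i : I) : ContDiff ℝ 1 (gibbsWeight z i) := by
  unfold gibbsWeight
  refine ContDiff.div ?_ ?_ fun w => (sum_exp_pos _).ne'
  · exact Real.contDiff_exp.comp (contDiff_id.inner ℝ contDiff_const)
  · exact ContDiff.sum fun j _ => Real.contDiff_exp.comp (contDiff_id.inner ℝ contDiff_const)

/-- Restriction to the line `t ↦ w + t • v` reduces the derivative to the one-variable quotient
rule. -/
theorem fderiv_gibbsWeight (z : I → E) (i : I) (w v : E) :
    fderiv ℝ (gibbsWeight z i) w v =
      gibbsWeight z i w * (inner ℝ v (z i) - ∑ j, gibbsWeight z j w * inner ℝ v (z j)) := by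
  have hd : ∀ j, HasDerivAt (fun t : ℝ => Real.exp (inner ℝ (w + t • v) (z j)))
      (Real.exp (inner ℝ w (z j)) * inner ℝ v (z j)) 0 := by
    intro j
    have h : HasDerivAt (fun t : ℝ => inner ℝ w (z j) + t * inner ℝ v (z j))
        (inner ℝ v (z j)) 0 := by
      simpa using ((hasDerivAt_id (0 : ℝ)).mul_const (inner ℝ v (z j))).const_add
        (inner ℝ w (z j))
    simpa [inner_add_left, real_inner_smul_left] using h.exp
  have hS : HasDerivAt (fun t : ℝ => ∑ j, Real.exp (inner ℝ (w + t • v) (z j)))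
      (∑ j, Real.exp (inner ℝ w (z j)) * inner ℝ v (z j)) 0 :=
    HasDerivAt.fun_sum fun j _ => hd j
  have hq := (hd i).fun_div hS (sum_exp_pos _).ne'
  have hline : HasDerivAt (fun t : ℝ => w + t • v) v 0 := by
    simpa using ((hasDerivAt_id (0 : ℝ)).smul_const v).const_add w
  have hf : HasFDerivAt (gibbsWeight z i) (fderiv ℝ (gibbsWeight z i) w) (w + (0 : ℝ) • v) := by
    rw [zero_smul, add_zero]
    exact ((contDiff_gibbsWeight z i).differentiable (by norm_num) w).hasFDerivAt
  have h1 := hf.comp_hasDerivAt (0 : ℝ) hline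
  have h2 := h1.unique hq
  rw [h2]
  simp only [gibbsWeight, zero_smul, add_zero, div_mul_eq_mul_div, ← Finset.sum_div]
  have := (sum_exp_pos (fun j => inner ℝ w (z j))).ne'
  field_simp

theorem abs_sum_gibbsWeight_mul_le (z : I → E) (w : E) {a : I → ℝ} {C : ℝ}
    (ha : ∀ i, |a i| ≤ C) : |∑ i, gibbsWeight z i w * a i| ≤ C := by
  calc |∑ i, gibbsWeight z i w * a i| ≤ ∑ i, |gibbsWeight z i w * a i| :=
        Finset.abs_sum_le_sum_abs _ _
    _ ≤ ∑ i, gibbsWeight z i w * C := by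
        refine Finset.sum_le_sum fun i _ => ?_
        rw [abs_mul, abs_of_nonneg (gibbsWeight_nonneg z i w)]
        exact mul_le_mul_of_nonneg_left (ha i) (gibbsWeight_nonneg z i w)
    _ = C := by rw [← Finset.sum_mul, sum_gibbsWeight, one_mul]

theorem log_sum_exp_le {f : I → ℝ} {M : ℝ} (h : ∀ i, f i ≤ M) :
    Real.log (∑ i, Real.exp (f i)) ≤ M + Real.log (Fintype.card I) := by
  have hc : (0 : ℝ) < Fintype.card I := by exact_mod_cast Fintype.card_pos
  rw [← Real.log_exp M, ← Real.log_mul (Real.exp_pos _).ne' hc.ne']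
  refine Real.log_le_log (sum_exp_pos f) ?_
  calc ∑ i, Real.exp (f i) ≤ ∑ _i : I, Real.exp M :=
        Finset.sum_le_sum fun i _ => Real.exp_le_exp.2 (h i)
    _ = Real.exp M * Fintype.card I := by
        rw [Finset.sum_const, nsmul_eq_mul, Finset.card_univ, mul_comm]

theorem abs_log_sum_exp_le {f : I → ℝ} {M : ℝ} (h : ∀ i, |f i| ≤ M) :
    |Real.log (∑ i, Real.exp (f i))| ≤ M + Real.log (Fintype.card I) := by
  refine abs_le.2 ⟨?_, log_sum_exp_le fun i => (abs_le.1 (h i)).2⟩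
  obtain ⟨i⟩ := ‹Nonempty I›
  have h1 := le_log_sum_exp f i
  have h2 := (abs_le.1 (h i)).1
  have h3 : 0 ≤ Real.log (Fintype.card I) := Real.log_natCast_nonneg _
  linarith

end Softmax

/-! ### Sudakov-Fernique comparison by Gaussian interpolation. -/

section Comparison

variable {E : Type*} [NormedAddCommGroup E] [InnerProductSpace ℝ E] [FiniteDimensional ℝ E]
  [MeasurableSpace E] [BorelSpace E] {I : Type*} [Fintype I] [Nonempty I]

theorem integrable_iSup_finite {Ω : Type*} [MeasurableSpace Ω] {μ : Measure Ω} {J : Type*}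
    [Finite J] [Nonempty J]
    {f : J → Ω → ℝ} (hf : ∀ i, Integrable (f i) μ) : Integrable (fun ω => ⨆ i, f i ω) μ := by
  have := Fintype.ofFinite J
  refine (integrable_finsetSum Finset.univ fun i _ => (hf i).norm).mono'
    (AEMeasurable.iSup fun i => (hf i).aemeasurable).aestronglyMeasurable
    (ae_of_all _ fun ω => ?_)
  have hle : ∀ i, ‖f i ω‖ ≤ ∑ j, ‖f j ω‖ := fun i =>
    Finset.single_le_sum (f := fun j => ‖f j ω‖) (fun j _ => norm_nonneg _) (Finset.mem_univ i)
  obtain ⟨i⟩ := ‹Nonempty J›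
  refine abs_le.2 ⟨?_, ciSup_le fun j => (le_abs_self _).trans (hle j)⟩
  exact (neg_le_of_abs_le (hle i)).trans (le_ciSup (f := fun i => f i ω)
    (Set.finite_range _).bddAbove i)

theorem integrable_log_sum_exp_stdGaussian (z : I → E) :
    Integrable (fun w => Real.log (∑ i, Real.exp (inner ℝ w (z i)))) (stdGaussian E) := by
  refine ((integrable_norm_stdGaussian.mul_const (∑ i, ‖z i‖)).add
    (integrable_const (Real.log (Fintype.card I)))).mono' ?_ (ae_of_all _ fun w => ?_)
  · exact Measurable.aestronglyMeasurable (by fun_prop)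
  · refine abs_log_sum_exp_le fun i => (abs_real_inner_le_norm _ _).trans ?_
    exact mul_le_mul_of_nonneg_left (Finset.single_le_sum (f := fun j => ‖z j‖)
      (fun j _ => norm_nonneg _) (Finset.mem_univ i)) (norm_nonneg _)

/-- Derivative of the Gaussian free energy along a path of vectors. -/
theorem integral_sum_gibbsWeight_mul_inner (z v : I → E) :
    ∫ w, ∑ i, gibbsWeight z i w * inner ℝ w (v i) ∂(stdGaussian E) =
      ∫ w, ∑ i, gibbsWeight z i w * (inner ℝ (v i) (z i) -
        ∑ j, gibbsWeight z j w * inner ℝ (v i) (z j)) ∂(stdGaussian E) := by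
  have hC : ∀ i w, |gibbsWeight z i w| ≤ 1 := fun i w => by
    rw [abs_of_nonneg (gibbsWeight_nonneg z i w)]
    exact gibbsWeight_le_one z i w
  have hC' : ∀ i w, |fderiv ℝ (gibbsWeight z i) w (v i)| ≤
      2 * (‖v i‖ * ∑ j, ‖z j‖) := by
    intro i w
    have hb : ∀ j, |inner ℝ (v i) (z j)| ≤ ‖v i‖ * ∑ j, ‖z j‖ := fun j =>
      (abs_real_inner_le_norm _ _).trans (mul_le_mul_of_nonneg_left (Finset.single_le_sum
        (f := fun j => ‖z j‖) (fun j _ => norm_nonneg _) (Finset.mem_univ j)) (norm_nonneg _))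
    rw [fderiv_gibbsWeight, abs_mul]
    refine (mul_le_of_le_one_left (abs_nonneg _) (hC i w)).trans ((abs_sub _ _).trans ?_)
    rw [two_mul]
    exact add_le_add (hb i) (abs_sum_gibbsWeight_mul_le z w hb)
  rw [integral_finsetSum, integral_finsetSum]
  · refine Finset.sum_congr rfl fun i _ => ?_
    simp_rw [← fderiv_gibbsWeight]
    rw [← integral_inner_mul_stdGaussian (contDiff_gibbsWeight z i) (v i) (hC i) (hC' i)]
    simp_rw [mul_comm]
  · intro i _
    simp_rw [← fderiv_gibbsWeight]
    exact (integrable_const _).mono' (((contDiff_gibbsWeight z i).continuous_fderiv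
      (by norm_num)).clm_apply continuous_const).aestronglyMeasurable (ae_of_all _ (hC' i))
  · intro i _
    exact (integrable_inner_stdGaussian (v i)).bdd_mul (c := 1)
      (contDiff_gibbsWeight z i).continuous.aestronglyMeasurable (ae_of_all _ (hC i))

/-- Gaussian comparison of free energies for two orthogonal families of vectors. -/
theorem integral_log_sum_exp_le {x y : I → E} (hxy : ∀ i j, inner ℝ (x i) (y j) = 0)
    (hdist : ∀ i j, ‖x i - x j‖ ≤ ‖y i - y j‖) :
    ∫ w, Real.log (∑ i, Real.exp (inner ℝ w (x i))) ∂(stdGaussian E) ≤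
      ∫ w, Real.log (∑ i, Real.exp (inner ℝ w (y i))) ∂(stdGaussian E) := by
  -- A rotation carries `x` at `θ = 0` to `y` at `θ = π/2`, with `v` its derivative in `θ`. The
  -- trigonometric path keeps this derivative bounded up to the endpoints.
  set z : ℝ → I → E := fun θ i => Real.cos θ • x i + Real.sin θ • y i with hz
  set v : ℝ → I → E := fun θ i => -Real.sin θ • x i + Real.cos θ • y i with hv
  have hvnorm : ∀ θ i, ‖v θ i‖ ≤ ∑ j, (‖x j‖ + ‖y j‖) := by
    intro θ i
    refine le_trans ?_ (Finset.single_le_sum (f := fun j => ‖x j‖ + ‖y j‖)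
      (fun j _ => by positivity) (Finset.mem_univ i))
    refine (norm_add_le _ _).trans (add_le_add ?_ ?_)
    · rw [norm_smul, norm_neg]
      exact mul_le_of_le_one_left (norm_nonneg _) (Real.abs_sin_le_one θ)
    · rw [norm_smul]
      exact mul_le_of_le_one_left (norm_nonneg _) (Real.abs_cos_le_one θ)
  have hder : ∀ θ, HasDerivAt
      (fun θ => ∫ w, Real.log (∑ i, Real.exp (inner ℝ w (z θ i))) ∂(stdGaussian E))
      (∫ w, ∑ i, gibbsWeight (z θ) i w * inner ℝ w (v θ i) ∂(stdGaussian E)) θ := by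
    intro θ
    refine (hasDerivAt_integral_of_dominated_loc_of_deriv_le
      (F' := fun θ w => ∑ i, gibbsWeight (z θ) i w * inner ℝ w (v θ i))
      (bound := fun w => ‖w‖ * ∑ j, (‖x j‖ + ‖y j‖)) Filter.univ_mem
      (Filter.Eventually.of_forall fun t =>
        (integrable_log_sum_exp_stdGaussian (z t)).aestronglyMeasurable)
      (integrable_log_sum_exp_stdGaussian (z θ)) ?_ ?_
      (integrable_norm_stdGaussian.mul_const _) ?_).2
    · refine Continuous.aestronglyMeasurable (continuous_finsetSum _ fun i _ => ?_)
      exact (contDiff_gibbsWeight _ i).continuous.mul (by fun_prop)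
    · refine ae_of_all _ fun w t _ => abs_sum_gibbsWeight_mul_le _ _ fun i => ?_
      exact (abs_real_inner_le_norm _ _).trans
        (mul_le_mul_of_nonneg_left (hvnorm t i) (norm_nonneg _))
    · refine ae_of_all _ fun w t _ => ?_
      have hd : ∀ j, HasDerivAt (fun t => Real.exp (inner ℝ w (z t j)))
          (Real.exp (inner ℝ w (z t j)) * inner ℝ w (v t j)) t := by
        intro j
        have h : HasDerivAt (fun t => Real.cos t * inner ℝ w (x j) + Real.sin t * inner ℝ w (y j))
            (-Real.sin t * inner ℝ w (x j) + Real.cos t * inner ℝ w (y j)) t :=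
          ((Real.hasDerivAt_cos t).mul_const _).add ((Real.hasDerivAt_sin t).mul_const _)
        simpa only [hz, hv, inner_add_right, real_inner_smul_right] using h.exp
      have h := (HasDerivAt.fun_sum fun j (_ : j ∈ Finset.univ) => hd j).log (sum_exp_pos _).ne'
      convert! h using 1
      simp only [gibbsWeight, div_mul_eq_mul_div, ← Finset.sum_div]
  -- Orthogonality of the two families, that is, independence of the two processes, kills the cross
  -- terms.
  have hK : ∀ θ i j, inner ℝ (v θ i) (z θ j) =
      Real.sin θ * Real.cos θ * (inner ℝ (y i) (y j) - inner ℝ (x i) (x j)) := by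
    intro θ i j
    simp only [hz, hv, inner_add_left, inner_add_right, real_inner_smul_left,
      real_inner_smul_right, hxy, real_inner_comm (x j) (y i)]
    ring
  have hmono : MonotoneOn
      (fun θ => ∫ w, Real.log (∑ i, Real.exp (inner ℝ w (z θ i))) ∂(stdGaussian E))
      (Set.Icc 0 (Real.pi / 2)) := by
    refine monotoneOn_of_deriv_nonneg (convex_Icc _ _)
      (fun θ _ => (hder θ).continuousAt.continuousWithinAt)
      (fun θ _ => (hder θ).differentiableAt.differentiableWithinAt) fun θ hθ => ?_
    rw [interior_Icc] at hθ
    rw [(hder θ).deriv, integral_sum_gibbsWeight_mul_inner]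
    refine integral_nonneg fun w => sum_mul_sub_sum_nonneg
      (K := fun i j => inner ℝ (v θ i) (z θ j))
      (fun i => gibbsWeight_nonneg _ i w) (sum_gibbsWeight _ w) fun i j => ?_
    have hsc : 0 ≤ Real.sin θ * Real.cos θ := mul_nonneg
      (Real.sin_nonneg_of_nonneg_of_le_pi hθ.1.le (by linarith [hθ.2, Real.pi_pos]))
      (Real.cos_nonneg_of_neg_pi_div_two_le_of_le (by linarith [hθ.1, Real.pi_pos]) hθ.2.le)
    have hd := pow_le_pow_left₀ (norm_nonneg _) (hdist i j) 2
    rw [norm_sub_sq_real, norm_sub_sq_real] at hd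
    simp only [hK, real_inner_self_eq_norm_sq]
    rw [real_inner_comm (y i) (y j), real_inner_comm (x i) (x j)]
    -- The kernel condition amounts to `sin θ cos θ (‖x i - x j‖² - ‖y i - y j‖²) ≤ 0`.
    nlinarith [mul_le_mul_of_nonneg_left hd hsc]
  have h := hmono (Set.left_mem_Icc.2 (by positivity)) (Set.right_mem_Icc.2 (by positivity))
    (by positivity)
  simpa [hz] using h

/-- The Sudakov-Fernique comparison inequality. -/
theorem integral_iSup_inner_le {x y : I → E} (hxy : ∀ i j, inner ℝ (x i) (y j) = 0)
    (hdist : ∀ i j, ‖x i - x j‖ ≤ ‖y i - y j‖) :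
    ∫ w, ⨆ i, inner ℝ w (x i) ∂(stdGaussian E) ≤ ∫ w, ⨆ i, inner ℝ w (y i) ∂(stdGaussian E) := by
  have hint : ∀ z : I → E, Integrable (fun w => ⨆ i, inner ℝ w (z i)) (stdGaussian E) :=
    fun z => integrable_iSup_finite fun i => integrable_inner_stdGaussian (z i)
  -- Scaling both families by the inverse temperature `β` divides the log-sum-exp error by `β`.
  have key : ∀ β : ℝ, 0 < β → ∫ w, ⨆ i, inner ℝ w (x i) ∂(stdGaussian E) ≤
      ∫ w, ⨆ i, inner ℝ w (y i) ∂(stdGaussian E) + Real.log (Fintype.card I) / β := by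
    intro β hβ
    have h := integral_log_sum_exp_le (x := fun i => β • x i) (y := fun i => β • y i)
      (fun i j => by simp [real_inner_smul_left, real_inner_smul_right, hxy])
      (fun i j => by
        rw [← smul_sub, ← smul_sub, norm_smul, norm_smul]
        exact mul_le_mul_of_nonneg_left (hdist i j) (norm_nonneg _))
    have h1 : β * ∫ w, ⨆ i, inner ℝ w (x i) ∂(stdGaussian E) ≤
        ∫ w, Real.log (∑ i, Real.exp (inner ℝ w (β • x i))) ∂(stdGaussian E) := by
      rw [← integral_const_mul]
      refine integral_mono ((hint x).const_mul β) (integrable_log_sum_exp_stdGaussian _)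
        fun w => ?_
      simp only
      rw [Real.mul_iSup_of_nonneg hβ.le]
      refine ciSup_le fun i => ?_
      rw [← real_inner_smul_right]
      exact le_log_sum_exp (fun i => inner ℝ w (β • x i)) i
    have h2 : ∫ w, Real.log (∑ i, Real.exp (inner ℝ w (β • y i))) ∂(stdGaussian E) ≤
        β * ∫ w, ⨆ i, inner ℝ w (y i) ∂(stdGaussian E) + Real.log (Fintype.card I) := by
      have e : ∫ w, (β * (⨆ i, inner ℝ w (y i)) + Real.log (Fintype.card I)) ∂(stdGaussian E) =
          β * ∫ w, ⨆ i, inner ℝ w (y i) ∂(stdGaussian E) + Real.log (Fintype.card I) := by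
        rw [integral_add ((hint y).const_mul β) (integrable_const _), integral_const_mul]
        simp
      rw [← e]
      refine integral_mono (integrable_log_sum_exp_stdGaussian _)
        (((hint y).const_mul β).add (integrable_const _)) fun w => log_sum_exp_le fun i => ?_
      rw [real_inner_smul_right]
      exact mul_le_mul_of_nonneg_left (le_ciSup (f := fun i => inner ℝ w (y i))
        (Set.finite_range _).bddAbove i) hβ.le
    have h3 := (h1.trans h).trans h2
    rw [← mul_le_mul_iff_right₀ hβ, mul_add, mul_div_cancel₀ _ hβ.ne']
    exact h3
  refine le_of_forall_pos_le_add fun ε hε => ?_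
  have hL : 0 ≤ Real.log (Fintype.card I) := Real.log_natCast_nonneg _
  -- The `+ 1` keeps `β` positive when `I` has a single element.
  refine (key ((Real.log (Fintype.card I) + 1) / ε) (by positivity)).trans ?_
  rw [div_div_eq_mul_div]
  have : Real.log (Fintype.card I) * ε / (Real.log (Fintype.card I) + 1) ≤ ε := by
    rw [div_le_iff₀ (by positivity)]
    nlinarith
  linarith

end Comparison

/-! ### Elementary tensors, spectral norm and nuclear norm. -/

section SpectralNorm

/-- The net lies inside `K`, so its points keep the defining property of `K`, while suprema over it
are finite and measurable. -/
theorem exists_finite_net {E : Type*} [PseudoMetricSpace E] [ProperSpace E]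
    {K : Set E} (hK : Bornology.IsBounded K) (hne : K.Nonempty) {ε : ℝ} (hε : 0 < ε) :
    ∃ F ⊆ K, F.Finite ∧ F.Nonempty ∧ ∀ X ∈ K, ∃ Y ∈ F, dist X Y ≤ ε := by
  obtain ⟨F, hFK, hF, hcov⟩ := Metric.finite_approx_of_totallyBounded
    (hK.isCompact_closure.totallyBounded.subset subset_closure) ε hε
  have h : ∀ X ∈ K, ∃ Y ∈ F, dist X Y ≤ ε := by
    intro X hX
    obtain ⟨Y, hY, hXY⟩ := Set.mem_iUnion₂.1 (hcov hX)
    exact ⟨Y, hY, (Metric.mem_ball.1 hXY).le⟩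
  obtain ⟨X, hX⟩ := hne
  obtain ⟨Y, hY, -⟩ := h X hX
  exact ⟨F, hFK, hF, ⟨Y, hY⟩, h⟩

namespace RealTensor

variable {D : ℕ} {n : Fin D → ℕ}

theorem inner_elementary (u v : (d : Fin D) → EuclideanSpace ℝ (Fin (n d))) :
    inner ℝ (elementary u) (elementary v) = ∏ d, inner ℝ (u d) (v d) := by
  simp only [PiLp.inner_apply, elementary, RCLike.inner_apply, conj_trivial]
  rw [Finset.prod_univ_sum, Fintype.piFinset_univ]
  simp_rw [Finset.prod_mul_distrib]

theorem norm_elementary (u : (d : Fin D) → EuclideanSpace ℝ (Fin (n d))) :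
    ‖elementary u‖ = ∏ d, ‖u d‖ := by
  have h : ‖elementary u‖ ^ 2 = (∏ d, ‖u d‖) ^ 2 := by
    rw [← real_inner_self_eq_norm_sq, inner_elementary, ← Finset.prod_pow]
    simp_rw [real_inner_self_eq_norm_sq]
  exact (pow_left_inj₀ (norm_nonneg _) (Finset.prod_nonneg fun d _ => norm_nonneg _)
    two_ne_zero).1 h

theorem norm_elementary_of_norm_eq_one {u : (d : Fin D) → EuclideanSpace ℝ (Fin (n d))}
    (hu : ∀ d, ‖u d‖ = 1) : ‖elementary u‖ = 1 := by
  simp [norm_elementary, hu]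

/-- The induction step is `(1 - a)(1 - b) ≥ 0`, i.e. `1 - ab ≤ (1 - a) + (1 - b)`. Negative values
are allowed because the `a i` will be inner products of unit vectors. -/
theorem prod_mem_Icc_and_one_sub_prod_le {ι : Type*} (s : Finset ι) {a : ι → ℝ}
    (ha : ∀ i, a i ∈ Set.Icc (-1) 1) :
    ∏ i ∈ s, a i ∈ Set.Icc (-1) 1 ∧ 1 - ∏ i ∈ s, a i ≤ ∑ i ∈ s, (1 - a i) := by
  classical
  induction s using Finset.induction_on with
  | empty => simp
  | insert i s hi ih =>
    rw [Finset.prod_insert hi, Finset.sum_insert hi]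
    obtain ⟨h1, h2⟩ := ha i
    obtain ⟨⟨h3, h4⟩, h5⟩ := ih
    refine ⟨abs_le.1 ?_, ?_⟩
    · rw [abs_mul]
      exact mul_le_one₀ (abs_le.2 ⟨h1, h2⟩) (abs_nonneg _) (abs_le.2 ⟨h3, h4⟩)
    · nlinarith [mul_nonneg (sub_nonneg.2 h2) (sub_nonneg.2 h4)]

/-- For unit vectors the squared distance is `2(1 - ⟨u, v⟩)`, and inner products of elementary
tensors multiply. This is the increment condition for Sudakov-Fernique. -/
theorem norm_elementary_sub_sq_le {u v : (d : Fin D) → EuclideanSpace ℝ (Fin (n d))}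
    (hu : ∀ d, ‖u d‖ = 1) (hv : ∀ d, ‖v d‖ = 1) :
    ‖elementary u - elementary v‖ ^ 2 ≤ ∑ d, ‖u d - v d‖ ^ 2 := by
  have h := (prod_mem_Icc_and_one_sub_prod_le Finset.univ
    (a := fun d => inner ℝ (u d) (v d)) fun d => by
      refine abs_le.1 ((abs_real_inner_le_norm _ _).trans ?_)
      simp [hu, hv]).2
  simp_rw [norm_sub_sq_real, hu, hv]
  rw [norm_elementary_of_norm_eq_one hu, norm_elementary_of_norm_eq_one hv, inner_elementary]
  calc (1 : ℝ) ^ 2 - 2 * ∏ d, inner ℝ (u d) (v d) + 1 ^ 2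
      = 2 * (1 - ∏ d, inner ℝ (u d) (v d)) := by ring
    _ ≤ 2 * ∑ d, (1 - inner ℝ (u d) (v d)) := by linarith
    _ = _ := by
      rw [Finset.mul_sum]
      exact Finset.sum_congr rfl fun d _ => by ring

theorem inner_elementary_le_norm (X : RealTensor n)
    {u : (d : Fin D) → EuclideanSpace ℝ (Fin (n d))} (hu : ∀ d, ‖u d‖ = 1) :
    inner ℝ X (elementary u) ≤ ‖X‖ := by
  simpa [norm_elementary_of_norm_eq_one hu] using real_inner_le_norm X (elementary u)

theorem inner_elementary_le_spectralNorm (X : RealTensor n)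
    {u : (d : Fin D) → EuclideanSpace ℝ (Fin (n d))} (hu : ∀ d, ‖u d‖ = 1) :
    inner ℝ X (elementary u) ≤ spectralNorm X := by
  refine le_csSup ⟨‖X‖, ?_⟩ ⟨u, hu, rfl⟩
  rintro r ⟨v, hv, rfl⟩
  exact inner_elementary_le_norm X hv

theorem exists_unit_vectors (hn : ∀ d, 0 < n d) :
    ∃ u : (d : Fin D) → EuclideanSpace ℝ (Fin (n d)), ∀ d, ‖u d‖ = 1 :=
  ⟨fun d => EuclideanSpace.single ⟨0, hn d⟩ 1, fun d => by simp⟩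

theorem spectralNorm_le (hn : ∀ d, 0 < n d) {X : RealTensor n} {r : ℝ}
    (h : ∀ u : (d : Fin D) → EuclideanSpace ℝ (Fin (n d)), (∀ d, ‖u d‖ = 1) →
      inner ℝ X (elementary u) ≤ r) : spectralNorm X ≤ r := by
  obtain ⟨u, hu⟩ := exists_unit_vectors hn
  refine csSup_le ⟨_, u, hu, rfl⟩ ?_
  rintro _ ⟨v, hv, rfl⟩
  exact h v hv

theorem spectralNorm_le_norm (hn : ∀ d, 0 < n d) (X : RealTensor n) : spectralNorm X ≤ ‖X‖ :=
  spectralNorm_le hn fun _ hu => inner_elementary_le_norm X hu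

theorem spectralNorm_add_le (hn : ∀ d, 0 < n d) (X Y : RealTensor n) :
    spectralNorm (X + Y) ≤ spectralNorm X + spectralNorm Y :=
  spectralNorm_le hn fun u hu => by
    rw [inner_add_left]
    exact add_le_add (inner_elementary_le_spectralNorm X hu)
      (inner_elementary_le_spectralNorm Y hu)

/-- Negating one factor negates the elementary tensor; this needs a factor to exist, hence `0 < D`.
-/
theorem abs_inner_elementary_le_spectralNorm (hD : 0 < D) (X : RealTensor n)
    {u : (d : Fin D) → EuclideanSpace ℝ (Fin (n d))} (hu : ∀ d, ‖u d‖ = 1) :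
    |inner ℝ X (elementary u)| ≤ spectralNorm X := by
  refine abs_le'.2 ⟨inner_elementary_le_spectralNorm X hu, ?_⟩
  set v := Function.update u ⟨0, hD⟩ (-u ⟨0, hD⟩) with hv
  have hvu : elementary v = -elementary u := by
    ext i
    have h1 : ∀ d, v d (i d) = (if d = ⟨0, hD⟩ then -1 else 1) * u d (i d) := by
      intro d
      by_cases hd : d = ⟨0, hD⟩
      · subst hd; simp [hv]
      · simp [hv, hd]
    simp only [elementary, PiLp.neg_apply, h1, Finset.prod_mul_distrib, Finset.prod_ite_eq',
      Finset.mem_univ, if_true]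
    ring
  have hv1 : ∀ d, ‖v d‖ = 1 := by
    intro d
    by_cases hd : d = ⟨0, hD⟩
    · subst hd; simp [hv, hu]
    · simp [hv, hd, hu]
  have := inner_elementary_le_spectralNorm X hv1
  rwa [hvu, inner_neg_right] at this

theorem spectralNorm_nonneg (hD : 0 < D) (hn : ∀ d, 0 < n d) (X : RealTensor n) :
    0 ≤ spectralNorm X := by
  obtain ⟨u, hu⟩ := exists_unit_vectors hn
  exact (abs_nonneg _).trans (abs_inner_elementary_le_spectralNorm hD X hu)

theorem spectralNorm_neg (hD : 0 < D) (hn : ∀ d, 0 < n d) (X : RealTensor n) :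
    spectralNorm (-X) = spectralNorm X := by
  have h : ∀ Y : RealTensor n, spectralNorm (-Y) ≤ spectralNorm Y := fun Y =>
    spectralNorm_le hn fun u hu => by
      rw [inner_neg_left]
      exact (neg_le_abs _).trans (abs_inner_elementary_le_spectralNorm hD Y hu)
  exact le_antisymm (h X) (by simpa using h (-X))

theorem spectralNorm_smul_le (hn : ∀ d, 0 < n d) {c : ℝ} (hc : 0 ≤ c) (X : RealTensor n) :
    spectralNorm (c • X) ≤ c * spectralNorm X :=
  spectralNorm_le hn fun u hu => by
    rw [real_inner_smul_left]
    exact mul_le_mul_of_nonneg_left (inner_elementary_le_spectralNorm X hu) hc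

theorem continuous_spectralNorm (hn : ∀ d, 0 < n d) :
    Continuous (spectralNorm : RealTensor n → ℝ) := by
  refine (LipschitzWith.of_le_add (f := (spectralNorm : RealTensor n → ℝ))
    fun X Y => ?_).continuous
  have := spectralNorm_add_le hn Y (X - Y)
  rw [add_sub_cancel] at this
  rw [dist_eq_norm]
  exact this.trans (add_le_add le_rfl (spectralNorm_le_norm hn _))

/-- Coordinate tensors are elementary, so each entry is at most one in absolute value. This crude
bound serves to make the supremum defining the nuclear norm a genuine one. -/
theorem norm_le_of_spectralNorm_le_one (hD : 0 < D) {X : RealTensor n}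
    (hX : spectralNorm X ≤ 1) : ‖X‖ ≤ √(Fintype.card ((d : Fin D) → Fin (n d))) := by
  have h : ∀ i, |X i| ≤ 1 := by
    intro i
    have h1 := abs_inner_elementary_le_spectralNorm hD X
      (u := fun d => EuclideanSpace.single (i d) 1) fun d => by simp
    have h2 : elementary (fun d => EuclideanSpace.single (i d) (1 : ℝ)) =
        (EuclideanSpace.single i 1 : RealTensor n) := by
      ext j
      simp only [elementary, PiLp.single_apply]
      rw [Finset.prod_ite_zero]
      simp [funext_iff]
    rw [h2, EuclideanSpace.inner_single_right] at h1
    simpa using h1.trans hX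
  rw [EuclideanSpace.norm_eq]
  refine Real.sqrt_le_sqrt ?_
  calc ∑ i, ‖X i‖ ^ 2 ≤ ∑ _i : (d : Fin D) → Fin (n d), (1 : ℝ) :=
        Finset.sum_le_sum fun i _ => pow_le_one₀ (norm_nonneg _) (h i)
    _ = _ := by simp

theorem bddAbove_nuclearNorm (hD : 0 < D) (X : RealTensor n) :
    BddAbove {r : ℝ | ∃ Y : RealTensor n, spectralNorm Y ≤ 1 ∧ r = inner ℝ X Y} := by
  refine ⟨‖X‖ * √(Fintype.card ((d : Fin D) → Fin (n d))), ?_⟩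
  rintro _ ⟨Y, hY, rfl⟩
  exact (real_inner_le_norm X Y).trans
    (mul_le_mul_of_nonneg_left (norm_le_of_spectralNorm_le_one hD hY) (norm_nonneg _))

theorem nuclearNorm_nonneg (hD : 0 < D) (hn : ∀ d, 0 < n d) (X : RealTensor n) :
    0 ≤ nuclearNorm X := by
  refine le_csSup (bddAbove_nuclearNorm hD X) ⟨0, ?_, by simp⟩
  exact spectralNorm_le hn fun u hu => by simp

/-- The nuclear norm is dual to the spectral norm. -/
theorem inner_le_nuclearNorm_mul_spectralNorm (hD : 0 < D) (hn : ∀ d, 0 < n d)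
    (X Y : RealTensor n) : inner ℝ X Y ≤ nuclearNorm X * spectralNorm Y := by
  -- A positive upper bound `s` avoids dividing by a possibly zero spectral norm.
  have key : ∀ s : ℝ, 0 < s → spectralNorm Y ≤ s → inner ℝ X Y ≤ nuclearNorm X * s := by
    intro s hs hY
    have h : inner ℝ X (s⁻¹ • Y) ≤ nuclearNorm X := by
      refine le_csSup (bddAbove_nuclearNorm hD X) ⟨_, ?_, rfl⟩
      refine (spectralNorm_smul_le hn (inv_nonneg.2 hs.le) Y).trans ?_
      rwa [inv_mul_le_iff₀ hs, mul_one]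
    rw [real_inner_smul_right, inv_mul_le_iff₀ hs] at h
    linarith
  have hX := nuclearNorm_nonneg hD hn X
  refine le_of_forall_pos_le_add fun ε hε => ?_
  have hδ : 0 < ε / (nuclearNorm X + 1) := by positivity
  refine (key (spectralNorm Y + ε / (nuclearNorm X + 1))
    (add_pos_of_nonneg_of_pos (spectralNorm_nonneg hD hn Y) hδ) (by linarith)).trans ?_
  rw [mul_add]
  have : nuclearNorm X * (ε / (nuclearNorm X + 1)) ≤ ε := by
    rw [mul_div_assoc', div_le_iff₀ (by positivity)]
    nlinarith
  linarith

/-- The triangle inequality in dual form: the difference lies in the nuclear-norm ball of twice the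
radius. -/
theorem inner_sub_le_of_nuclearNorm_le (hD : 0 < D) (hn : ∀ d, 0 < n d) {X X' : RealTensor n}
    (h : nuclearNorm X ≤ nuclearNorm X') (Y : RealTensor n) :
    inner ℝ (X - X') Y ≤ 2 * nuclearNorm X' * spectralNorm Y := by
  have h1 := inner_le_nuclearNorm_mul_spectralNorm hD hn X Y
  have h2 := inner_le_nuclearNorm_mul_spectralNorm hD hn X' (-Y)
  rw [spectralNorm_neg hD hn, inner_neg_right] at h2
  have h3 := mul_le_mul_of_nonneg_right h (spectralNorm_nonneg hD hn Y)
  rw [inner_sub_left]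
  linarith

theorem integrable_spectralNorm (hD : 0 < D) (hn : ∀ d, 0 < n d) :
    Integrable (fun g : RealTensor n => spectralNorm g) (stdGaussian (RealTensor n)) :=
  integrable_norm_stdGaussian.mono' (continuous_spectralNorm hn).aestronglyMeasurable
    (ae_of_all _ fun g => by
      rw [Real.norm_eq_abs, abs_of_nonneg (spectralNorm_nonneg hD hn g)]
      exact spectralNorm_le_norm hn g)

/-! ### Expected spectral norm of a Gaussian tensor. -/

/-- Pairs of a tensor and a tuple of vectors, with the Euclidean norm. -/
abbrev TensorVectorSpace (n : Fin D → ℕ) : Type :=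
  EuclideanSpace ℝ (((d : Fin D) → Fin (n d)) ⊕ ((d : Fin D) × Fin (n d)))

/-- The Gaussian width of a finite set of elementary unit tensors. -/
theorem integral_iSup_inner_elementary_le {I : Type*} [Fintype I] [Nonempty I]
    {u : I → (d : Fin D) → EuclideanSpace ℝ (Fin (n d))} (hu : ∀ i d, ‖u i d‖ = 1) :
    ∫ g : RealTensor n, ⨆ i, inner ℝ g (elementary (u i)) ∂(stdGaussian (RealTensor n)) ≤
      ∑ d, √(n d : ℝ) := by
  -- `J` fills the tensor coordinates and `y` below the vector coordinates, so both processes live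
  -- on one Gaussian space as orthogonal families.
  let J : RealTensor n → TensorVectorSpace n := fun t => WithLp.toLp 2 (Sum.elim t fun _ => 0)
  let L : TensorVectorSpace n →L[ℝ] RealTensor n := LinearMap.toContinuousLinearMap
    { toFun := fun w => WithLp.toLp 2 fun i => w (Sum.inl i)
      map_add' := fun _ _ => rfl
      map_smul' := fun _ _ => rfl }
  have hLJ : ∀ w t, inner ℝ (L w) t = inner ℝ w (J t) := by
    intro w t
    simp only [L, J, PiLp.inner_apply, Fintype.sum_sum_type]
    simp
    rfl
  have hJ : ∀ t, ‖J t‖ = ‖t‖ := by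
    intro t
    simp [J, EuclideanSpace.norm_eq]
  have hJsub : ∀ s t, J s - J t = J (s - t) := by
    intro s t
    ext k
    rcases k with k | k <;> simp [J]
  let y : I → TensorVectorSpace n := fun i =>
    WithLp.toLp 2 (Sum.elim (fun _ => 0) fun k => u i k.1 k.2)
  have hy : ∀ i j, ‖y i - y j‖ ^ 2 = ∑ d, ‖u i d - u j d‖ ^ 2 := by
    intro i j
    rw [EuclideanSpace.real_norm_sq_eq, Fintype.sum_sum_type, Fintype.sum_sigma]
    simp [y, EuclideanSpace.real_norm_sq_eq]
  have hcomp := integral_iSup_inner_le (x := fun i => J (elementary (u i))) (y := y)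
    (fun i j => by simp [J, y, PiLp.inner_apply])
    (fun i j => by
      refine (pow_le_pow_iff_left₀ (norm_nonneg _) (norm_nonneg _) two_ne_zero).1 ?_
      rw [hJsub, hJ, hy]
      exact norm_elementary_sub_sq_le (hu i) (hu j))
  have hx : ∫ g : RealTensor n, ⨆ i, inner ℝ g (elementary (u i)) ∂(stdGaussian (RealTensor n)) =
      ∫ w, ⨆ i, inner ℝ w (J (elementary (u i))) ∂(stdGaussian (TensorVectorSpace n)) := by
    rw [← map_stdGaussian_of_inner_eq hLJ hJ, integral_map (by fun_prop)
      (Measurable.aestronglyMeasurable (Measurable.iSup fun i => by fun_prop))]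
    simp_rw [hLJ]
  rw [hx]
  refine hcomp.trans ?_
  have hcoord : ∀ k,
      ∫ w : TensorVectorSpace n, w k ^ 2 ∂(stdGaussian (TensorVectorSpace n)) = 1 := by
    intro k
    have := integral_inner_sq_stdGaussian (EuclideanSpace.single k 1 : TensorVectorSpace n)
    simpa [EuclideanSpace.inner_single_right] using this
  have hcoordi : ∀ k, Integrable (fun w : TensorVectorSpace n => w k ^ 2)
      (stdGaussian (TensorVectorSpace n)) := fun k =>
    -- A non-integrable function would have integral zero by convention.
    Integrable.of_integral_ne_zero (by rw [hcoord]; norm_num)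
  have hNm : ∀ d, Continuous
      fun w : TensorVectorSpace n => √(∑ k : Fin (n d), w (Sum.inr ⟨d, k⟩) ^ 2) := by
    intro d
    fun_prop
  have hsq : ∀ d, Integrable
      (fun w : TensorVectorSpace n => √(∑ k : Fin (n d), w (Sum.inr ⟨d, k⟩) ^ 2) ^ 2)
      (stdGaussian (TensorVectorSpace n)) := by
    intro d
    refine (integrable_finsetSum Finset.univ
      fun (k : Fin (n d)) _ => hcoordi (Sum.inr ⟨d, k⟩)).congr (ae_of_all _ fun w => ?_)
    exact (Real.sq_sqrt (Finset.sum_nonneg fun k _ => sq_nonneg _)).symm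
  have hL2 : ∀ d, MemLp
      (fun w : TensorVectorSpace n => √(∑ k : Fin (n d), w (Sum.inr ⟨d, k⟩) ^ 2)) 2
      (stdGaussian (TensorVectorSpace n)) := fun d =>
    (memLp_two_iff_integrable_sq (hNm d).aestronglyMeasurable).2 (hsq d)
  have hN : ∀ d, ∫ w : TensorVectorSpace n,
      √(∑ k : Fin (n d), w (Sum.inr ⟨d, k⟩) ^ 2) ∂(stdGaussian (TensorVectorSpace n)) ≤
      √(n d : ℝ) := by
    intro d
    refine Real.le_sqrt_of_sq_le ?_
    -- Nonnegative variance gives `(E‖w_d‖)² ≤ E‖w_d‖² = n d`, where `w_d` is the `d`-th block of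
    -- `w`.
    have hvar := variance_nonneg
      (fun w : TensorVectorSpace n => √(∑ k : Fin (n d), w (Sum.inr ⟨d, k⟩) ^ 2))
      (stdGaussian (TensorVectorSpace n))
    rw [variance_eq_sub (hL2 d)] at hvar
    refine (sub_nonneg.1 hvar).trans (le_of_eq ?_)
    have : ∀ w : TensorVectorSpace n,
        ((fun w : TensorVectorSpace n => √(∑ k : Fin (n d), w (Sum.inr ⟨d, k⟩) ^ 2)) ^ 2) w =
        ∑ k : Fin (n d), w (Sum.inr ⟨d, k⟩) ^ 2 := fun w =>
      Real.sq_sqrt (Finset.sum_nonneg fun k _ => sq_nonneg _)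
    simp_rw [this]
    rw [integral_finsetSum _ fun (k : Fin (n d)) _ => hcoordi (Sum.inr ⟨d, k⟩)]
    simp [hcoord]
  -- Cauchy-Schwarz in each block bounds the supremum by the sum of the block norms.
  refine le_trans ?_ (Finset.sum_le_sum fun d _ => hN d)
  rw [← integral_finsetSum _ fun d _ => (hL2 d).integrable (by norm_num)]
  refine integral_mono (integrable_iSup_finite fun i => integrable_inner_stdGaussian (y i))
    (integrable_finsetSum _ fun d _ => (hL2 d).integrable (by norm_num))
    fun w => ciSup_le fun i => ?_
  simp only [y, PiLp.inner_apply, Fintype.sum_sum_type, Fintype.sum_sigma]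
  simp only [Sum.elim_inl, Sum.elim_inr, inner_zero_right, Finset.sum_const_zero, zero_add]
  refine Finset.sum_le_sum fun d _ => ?_
  have := real_inner_le_norm (WithLp.toLp 2 fun k => w (Sum.inr ⟨d, k⟩)) (u i d)
  rw [hu, mul_one, EuclideanSpace.norm_eq, PiLp.inner_apply] at this
  simpa using this

/-- The expected spectral norm of a standard Gaussian tensor. -/
theorem integral_spectralNorm_stdGaussian_le (hD : 0 < D) (hn : ∀ d, 0 < n d) :
    ∫ g : RealTensor n, spectralNorm g ∂(stdGaussian (RealTensor n)) ≤ ∑ d, √(n d : ℝ) := by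
  set K : Set (RealTensor n) := {X | ∃ u : (d : Fin D) → EuclideanSpace ℝ (Fin (n d)),
    (∀ d, ‖u d‖ = 1) ∧ elementary u = X} with hK
  have hKb : Bornology.IsBounded K := by
    refine (Metric.isBounded_closedBall (x := (0 : RealTensor n)) (r := 1)).subset ?_
    rintro _ ⟨u, hu, rfl⟩
    simp [norm_elementary_of_norm_eq_one hu]
  obtain ⟨u₀, hu₀⟩ := exists_unit_vectors hn
  set N := ∫ g : RealTensor n, ‖g‖ ∂(stdGaussian (RealTensor n)) with hN
  have hN0 : 0 ≤ N := integral_nonneg fun g => norm_nonneg g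
  refine le_of_forall_pos_le_add fun δ hδ => ?_
  set ε := δ / (N + 1) with hε
  have hε0 : 0 < ε := by positivity
  obtain ⟨F, hFK, hF, hFne, hcov⟩ := exists_finite_net hKb ⟨_, u₀, hu₀, rfl⟩ hε0
  have := hF.fintype
  have := hFne.to_subtype
  choose u hu hue using fun Y : F => hFK Y.2
  have hpt : ∀ g : RealTensor n,
      spectralNorm g ≤ (⨆ i, inner ℝ g (elementary (u i))) + ε * ‖g‖ := by
    intro g
    refine spectralNorm_le hn fun v hv => ?_
    obtain ⟨Y, hYF, hY⟩ := hcov _ ⟨v, hv, rfl⟩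
    have h1 : inner ℝ g (elementary v) =
        inner ℝ g (elementary (u ⟨Y, hYF⟩)) + inner ℝ g (elementary v - Y) := by
      rw [hue, ← inner_add_right, add_sub_cancel]
    rw [h1]
    refine add_le_add (le_ciSup (f := fun i => inner ℝ g (elementary (u i)))
      (Set.finite_range _).bddAbove ⟨Y, hYF⟩) ((real_inner_le_norm _ _).trans ?_)
    rw [mul_comm ε]
    rw [dist_eq_norm] at hY
    exact mul_le_mul_of_nonneg_left hY (norm_nonneg _)
  have hi := integrable_iSup_finite
    fun i => integrable_inner_stdGaussian (elementary (u i))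
  have h := integral_mono (integrable_spectralNorm hD hn)
    (hi.add (integrable_norm_stdGaussian.const_mul ε)) hpt
  refine h.trans ?_
  simp only [Pi.add_apply]
  rw [integral_add hi (integrable_norm_stdGaussian.const_mul ε), integral_const_mul]
  refine add_le_add (integral_iSup_inner_elementary_le hu) ?_
  rw [← hN, hε, div_mul_eq_mul_div, div_le_iff₀ (by positivity)]
  nlinarith

end RealTensor

end SpectralNorm

/-! ### Symmetrization and contraction for absolute values of Gaussian functionals. -/

section KernelWidth

variable {E : Type*} [NormedAddCommGroup E] [InnerProductSpace ℝ E] [FiniteDimensional ℝ E]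
  [MeasurableSpace E] [BorelSpace E] {I : Type*} [Finite I] [Nonempty I]

/-- Let `i`, `j` be maximizers on the left. The sign of `x i` decides which supremum on the right
receives `i`; the other receives `j`, as `-|x j|` is below both `x j` and `-x j`. -/
theorem iSup_add_abs_add_iSup_sub_abs_le (B x : I → ℝ) :
    (⨆ i, (B i + |x i|)) + (⨆ i, (B i - |x i|)) ≤ (⨆ i, (B i + x i)) + ⨆ i, (B i - x i) := by
  obtain ⟨i, hi⟩ := exists_eq_ciSup_of_finite (f := fun i => B i + |x i|)
  obtain ⟨j, hj⟩ := exists_eq_ciSup_of_finite (f := fun i => B i - |x i|)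
  rw [← hi, ← hj]
  have hp : ∀ k, B k + x k ≤ ⨆ i, (B i + x i) :=
    le_ciSup (f := fun i => B i + x i) (Set.finite_range _).bddAbove
  have hm : ∀ k, B k - x k ≤ ⨆ i, (B i - x i) :=
    le_ciSup (f := fun i => B i - x i) (Set.finite_range _).bddAbove
  rcases abs_cases (x i) with ⟨h, -⟩ | ⟨h, -⟩
  · linarith [hp i, hm j, le_abs_self (x j)]
  · linarith [hm i, hp j, neg_le_abs (x j)]

/-- Symmetrization and contraction for a single Gaussian functional. -/
theorem integral_iSup_sub_abs_inner_le (B : I → ℝ) (u : I → E) :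
    ∫ a, ⨆ i, (B i + (√(2 / Real.pi) * ‖u i‖ - |inner ℝ a (u i)|)) ∂(stdGaussian E) ≤
      ∫ a, ⨆ i, (B i + 2 * inner ℝ a (u i)) ∂(stdGaussian E) := by
  have hle : ∀ (f : I → ℝ) i, f i ≤ ⨆ j, f j := fun f i =>
    le_ciSup (Set.finite_range f).bddAbove i
  have habs : ∀ i, Integrable (fun a => |inner ℝ a (u i)|) (stdGaussian E) := fun i =>
    (integrable_inner_stdGaussian (u i)).abs
  have i1 : Integrable (fun a => ⨆ i, (B i / 2 + |inner ℝ a (u i)|)) (stdGaussian E) :=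
    integrable_iSup_finite fun i => (integrable_const _).add (habs i)
  have i2 : Integrable (fun a => ⨆ i, (B i / 2 - |inner ℝ a (u i)|)) (stdGaussian E) :=
    integrable_iSup_finite fun i => (integrable_const _).sub (habs i)
  have i3 : Integrable (fun a => ⨆ i, (B i / 2 + inner ℝ a (u i))) (stdGaussian E) :=
    integrable_iSup_finite fun i => (integrable_const _).add (integrable_inner_stdGaussian _)
  have i4 : Integrable (fun a => ⨆ i, (B i / 2 - inner ℝ a (u i))) (stdGaussian E) :=
    integrable_iSup_finite fun i => (integrable_const _).sub (integrable_inner_stdGaussian _)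
  -- Jensen: `√(2/π) ‖u i‖` is the mean of `|⟨a, u i⟩|`. Halving `B` lets the two equal suprema of
  -- `B/2 + ⟨a, u⟩` obtained at the end add up to that of `B + 2⟨a, u⟩`.
  have h1 : (⨆ i, (B i / 2 + √(2 / Real.pi) * ‖u i‖)) ≤
      ∫ a, ⨆ i, (B i / 2 + |inner ℝ a (u i)|) ∂(stdGaussian E) := by
    refine ciSup_le fun i => ?_
    have : B i / 2 + √(2 / Real.pi) * ‖u i‖ =
        ∫ a, (B i / 2 + |inner ℝ a (u i)|) ∂(stdGaussian E) := by
      rw [integral_add (integrable_const _) (habs i), integral_abs_inner_stdGaussian]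
      simp
    rw [this]
    exact integral_mono ((integrable_const _).add (habs i)) i1 fun a =>
      hle (fun i => B i / 2 + |inner ℝ a (u i)|) i
  have h2 : ∫ a, ⨆ i, (B i + (√(2 / Real.pi) * ‖u i‖ - |inner ℝ a (u i)|)) ∂(stdGaussian E) ≤
      ∫ a, ((⨆ i, (B i / 2 + √(2 / Real.pi) * ‖u i‖)) +
        ⨆ i, (B i / 2 - |inner ℝ a (u i)|)) ∂(stdGaussian E) := by
    refine integral_mono (integrable_iSup_finite fun i =>
      (integrable_const _).add ((integrable_const _).sub (habs i)))
      ((integrable_const _).add i2) fun a => ciSup_le fun i => ?_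
    have e1 := hle (fun i => B i / 2 + √(2 / Real.pi) * ‖u i‖) i
    have e2 := hle (fun i => B i / 2 - |inner ℝ a (u i)|) i
    linarith
  have h3 : ∫ a, ⨆ i, (B i / 2 - inner ℝ a (u i)) ∂(stdGaussian E) =
      ∫ a, ⨆ i, (B i / 2 + inner ℝ a (u i)) ∂(stdGaussian E) := by
    conv_rhs => rw [← map_neg_stdGaussian, integral_map (by fun_prop)
      (Measurable.aestronglyMeasurable (Measurable.iSup fun i => by fun_prop))]
    simp_rw [inner_neg_left, sub_eq_add_neg]
  have h4 : ∫ a, ⨆ i, (B i + 2 * inner ℝ a (u i)) ∂(stdGaussian E) =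
      2 * ∫ a, ⨆ i, (B i / 2 + inner ℝ a (u i)) ∂(stdGaussian E) := by
    rw [← integral_const_mul]
    refine integral_congr_ae (ae_of_all _ fun a => ?_)
    simp only
    rw [Real.mul_iSup_of_nonneg (by norm_num)]
    refine congrArg iSup (funext fun i => ?_)
    ring
  calc _ ≤ _ := h2
    _ = (⨆ i, (B i / 2 + √(2 / Real.pi) * ‖u i‖)) +
        ∫ a, ⨆ i, (B i / 2 - |inner ℝ a (u i)|) ∂(stdGaussian E) := by
      rw [integral_add (integrable_const _) i2]
      simp
    _ ≤ ∫ a, ((⨆ i, (B i / 2 + |inner ℝ a (u i)|)) +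
        ⨆ i, (B i / 2 - |inner ℝ a (u i)|)) ∂(stdGaussian E) := by
      rw [integral_add i1 i2]
      linarith
    _ ≤ ∫ a, ((⨆ i, (B i / 2 + inner ℝ a (u i))) +
        ⨆ i, (B i / 2 - inner ℝ a (u i))) ∂(stdGaussian E) :=
      integral_mono (i1.add i2) (i3.add i4) fun a =>
        iSup_add_abs_add_iSup_sub_abs_le (fun i => B i / 2) fun i => inner ℝ a (u i)
    _ = _ := by rw [integral_add i3 i4, h3, h4, two_mul]

theorem integrable_inner_eval_pi_stdGaussian {m : ℕ} (k : Fin m) (v : E) :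
    Integrable (fun a : Fin m → E => inner ℝ (a k) v)
      (Measure.pi fun _ : Fin m => stdGaussian E) :=
  (measurePreserving_eval (fun _ : Fin m => stdGaussian E) k).integrable_comp_of_integrable
    (integrable_inner_stdGaussian v)

/-- Symmetrization and contraction for `m` independent Gaussian functionals. -/
theorem integral_iSup_sum_sub_abs_inner_le (u : I → E) (m : ℕ) (B : I → ℝ) :
    ∫ a, ⨆ i, (B i + ∑ k, (√(2 / Real.pi) * ‖u i‖ - |inner ℝ (a k) (u i)|))
        ∂(Measure.pi fun _ : Fin m => stdGaussian E) ≤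
      ∫ a, ⨆ i, (B i + 2 * inner ℝ (∑ k, a k) (u i))
        ∂(Measure.pi fun _ : Fin m => stdGaussian E) := by
  -- An arbitrary `B` absorbs the other terms: the induction hypothesis is used with the first
  -- functional frozen, then the one-functional bound with the rest frozen.
  induction m generalizing B with
  | zero => simp
  | succ m ih =>
    have hmp := (measurePreserving_piFinSuccAbove (fun _ : Fin (m + 1) => stdGaussian E) 0).symm
    have hfst : ∀ i, Integrable (fun p : E × (Fin m → E) => inner ℝ p.1 (u i))
        ((stdGaussian E).prod (Measure.pi fun _ : Fin m => stdGaussian E)) := fun i =>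
      (integrable_inner_stdGaussian (u i)).comp_fst _
    have hsnd : ∀ k i, Integrable (fun p : E × (Fin m → E) => inner ℝ (p.2 k) (u i))
        ((stdGaussian E).prod (Measure.pi fun _ : Fin m => stdGaussian E)) := fun k i =>
      (integrable_inner_eval_pi_stdGaussian k (u i)).comp_snd _
    have hi1 : Integrable (fun p : E × (Fin m → E) => ⨆ i,
        (B i + (√(2 / Real.pi) * ‖u i‖ - |inner ℝ p.1 (u i)|) +
          ∑ k, (√(2 / Real.pi) * ‖u i‖ - |inner ℝ (p.2 k) (u i)|)))
        ((stdGaussian E).prod (Measure.pi fun _ : Fin m => stdGaussian E)) :=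
      integrable_iSup_finite fun i => ((integrable_const _).add ((integrable_const _).sub
        (hfst i).abs)).add
        (integrable_finsetSum _ fun k _ => (integrable_const _).sub
          (hsnd k i).abs)
    have hi2 : Integrable (fun p : E × (Fin m → E) => ⨆ i,
        (B i + (√(2 / Real.pi) * ‖u i‖ - |inner ℝ p.1 (u i)|) +
          2 * inner ℝ (∑ k, p.2 k) (u i)))
        ((stdGaussian E).prod (Measure.pi fun _ : Fin m => stdGaussian E)) := by
      simp_rw [sum_inner]
      exact integrable_iSup_finite fun i => ((integrable_const _).add ((integrable_const _).sub
        (hfst i).abs)).add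
        ((integrable_finsetSum _ fun k _ =>
          hsnd k i).const_mul 2)
    have hi3 : Integrable (fun p : E × (Fin m → E) => ⨆ i,
        (B i + 2 * inner ℝ (∑ k, p.2 k) (u i) + 2 * inner ℝ p.1 (u i)))
        ((stdGaussian E).prod (Measure.pi fun _ : Fin m => stdGaussian E)) := by
      simp_rw [sum_inner]
      exact integrable_iSup_finite fun i => ((integrable_const _).add
        ((integrable_finsetSum _ fun k _ =>
          hsnd k i).const_mul 2)).add
        ((hfst i).const_mul 2)
    have hi2' : Integrable (fun p : E × (Fin m → E) => ⨆ i,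
        (B i + 2 * inner ℝ (∑ k, p.2 k) (u i) +
          (√(2 / Real.pi) * ‖u i‖ - |inner ℝ p.1 (u i)|)))
        ((stdGaussian E).prod (Measure.pi fun _ : Fin m => stdGaussian E)) := by
      simpa only [add_right_comm] using hi2
    rw [← hmp.integral_comp' (g := fun a => ⨆ i, (B i +
        ∑ k, (√(2 / Real.pi) * ‖u i‖ - |inner ℝ (a k) (u i)|))),
      ← hmp.integral_comp' (g := fun a => ⨆ i, (B i + 2 * inner ℝ (∑ k, a k) (u i)))]
    have hcons : ∀ p : E × (Fin m → E),
        (MeasurableEquiv.piFinSuccAbove (fun _ => E) (0 : Fin (m + 1))).symm p =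
          Fin.cons p.1 p.2 := fun p => by
      simp [MeasurableEquiv.piFinSuccAbove, Fin.insertNthEquiv]
    simp only [hcons, Fin.sum_univ_succ, Fin.cons_zero, Fin.cons_succ]
    calc _ = ∫ p : E × (Fin m → E), ⨆ i,
          (B i + (√(2 / Real.pi) * ‖u i‖ - |inner ℝ p.1 (u i)|) +
            ∑ k, (√(2 / Real.pi) * ‖u i‖ - |inner ℝ (p.2 k) (u i)|))
          ∂((stdGaussian E).prod (Measure.pi fun _ : Fin m => stdGaussian E)) := by
          simp only [add_assoc]
      _ ≤ ∫ p : E × (Fin m → E), ⨆ i,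
          (B i + (√(2 / Real.pi) * ‖u i‖ - |inner ℝ p.1 (u i)|) +
            2 * inner ℝ (∑ k, p.2 k) (u i))
          ∂((stdGaussian E).prod (Measure.pi fun _ : Fin m => stdGaussian E)) := by
          rw [integral_prod _ hi1, integral_prod _ hi2]
          exact integral_mono hi1.integral_prod_left hi2.integral_prod_left fun a₀ =>
            ih fun i => B i + (√(2 / Real.pi) * ‖u i‖ - |inner ℝ a₀ (u i)|)
      _ = ∫ p : E × (Fin m → E), ⨆ i,
          (B i + 2 * inner ℝ (∑ k, p.2 k) (u i) +
            (√(2 / Real.pi) * ‖u i‖ - |inner ℝ p.1 (u i)|))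
          ∂((stdGaussian E).prod (Measure.pi fun _ : Fin m => stdGaussian E)) := by
          simp only [add_right_comm]
      _ ≤ ∫ p : E × (Fin m → E), ⨆ i,
          (B i + 2 * inner ℝ (∑ k, p.2 k) (u i) + 2 * inner ℝ p.1 (u i))
          ∂((stdGaussian E).prod (Measure.pi fun _ : Fin m => stdGaussian E)) := by
          rw [integral_prod_symm _ hi2', integral_prod_symm _ hi3]
          exact integral_mono hi2'.integral_prod_right hi3.integral_prod_right fun a =>
            integral_iSup_sub_abs_inner_le (fun i => B i + 2 * inner ℝ (∑ k, a k) (u i)) u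
      _ = _ := by
          refine integral_congr_ae (ae_of_all _ fun p => congrArg iSup (funext fun i => ?_))
          simp only [inner_add_left]
          ring

end KernelWidth

/-! ### Random kernel sections of the nuclear-norm ball, and the conclusion. -/

namespace RealTensor

variable {D : ℕ} {n : Fin D → ℕ}

/-- The sum has the law of `√m` times one Gaussian tensor. Set against the factor `m` on the left of
the kernel estimate, this gives the rate `1/√m`. -/
theorem integral_spectralNorm_sum_pi_le (hD : 0 < D) (hn : ∀ d, 0 < n d) (m : ℕ) :
    ∫ a : Fin m → RealTensor n, spectralNorm (∑ k, a k)
        ∂(Measure.pi fun _ : Fin m => stdGaussian (RealTensor n)) ≤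
      √(m : ℝ) * ∑ d, √(n d : ℝ) := by
  have hc := continuous_spectralNorm hn
  rw [← integral_map (φ := fun a : Fin m → RealTensor n => ∑ k, a k) (by fun_prop)
    hc.aestronglyMeasurable, map_sum_pi_stdGaussian, integral_map (by fun_prop)
    hc.aestronglyMeasurable]
  calc _ ≤ ∫ g : RealTensor n, √(m : ℝ) * spectralNorm g ∂(stdGaussian (RealTensor n)) := by
        refine integral_mono_of_nonneg (ae_of_all _ fun g => spectralNorm_nonneg hD hn _)
          ((integrable_spectralNorm hD hn).const_mul _)
          (ae_of_all _ fun g => spectralNorm_smul_le hn (Real.sqrt_nonneg _) g)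
    _ ≤ _ := by
        rw [integral_const_mul]
        exact mul_le_mul_of_nonneg_left (integral_spectralNorm_stdGaussian_le hD hn)
          (Real.sqrt_nonneg _)

theorem integrable_spectralNorm_sum_pi (hD : 0 < D) (hn : ∀ d, 0 < n d) (m : ℕ) :
    Integrable (fun a : Fin m → RealTensor n => spectralNorm (∑ k, a k))
      (Measure.pi fun _ : Fin m => stdGaussian (RealTensor n)) := by
  have h : Integrable (fun a : Fin m → RealTensor n => ∑ k, ‖a k‖)
      (Measure.pi fun _ : Fin m => stdGaussian (RealTensor n)) :=
    integrable_finsetSum _ fun k _ => (measurePreserving_eval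
      (fun _ : Fin m => stdGaussian (RealTensor n)) k).integrable_comp_of_integrable
      integrable_norm_stdGaussian
  refine h.mono' ((continuous_spectralNorm hn).comp (by fun_prop)).aestronglyMeasurable
    (ae_of_all _ fun a => ?_)
  rw [Real.norm_eq_abs, abs_of_nonneg (spectralNorm_nonneg hD hn _)]
  exact (spectralNorm_le_norm hn _).trans (norm_sum_le _ _)

/-- A bound for the mean diameter of a random section, by the kernel of `m` independent Gaussian
functionals, of the ball of radius `R` for the norm dual to the spectral norm. -/
theorem integral_norm_le_of_inner_eq_zero (hD : 0 < D) (hn : ∀ d, 0 < n d) {m : ℕ} (hm : 0 < m)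
    {Ω : Type*} [MeasurableSpace Ω] {P : Measure Ω} [IsProbabilityMeasure P]
    {G : Ω → Fin m → RealTensor n}
    (hG : HasLaw G (Measure.pi fun _ : Fin m => stdGaussian (RealTensor n)) P)
    {h : Ω → RealTensor n} (hh : AEMeasurable h P) {R : ℝ} (hR : 0 ≤ R)
    (hker : ∀ᵐ ω ∂P, ∀ k, inner ℝ (G ω k) (h ω) = 0)
    (hball : ∀ᵐ ω ∂P, ∀ Y, inner ℝ (h ω) Y ≤ R * spectralNorm Y) :
    Integrable (fun ω => ‖h ω‖) P ∧
      ∫ ω, ‖h ω‖ ∂P ≤ √(2 * Real.pi) * R * ((∑ d, √(n d : ℝ)) / √(m : ℝ)) := by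
  -- Testing the dual bound at `Y = X` makes the ball Frobenius-bounded, which gives integrability
  -- and finite nets.
  have hnorm : ∀ X : RealTensor n, (∀ Y, inner ℝ X Y ≤ R * spectralNorm Y) → ‖X‖ ≤ R := by
    intro X hX
    have h1 := (hX X).trans (mul_le_mul_of_nonneg_left (spectralNorm_le_norm hn X) hR)
    rw [real_inner_self_eq_norm_sq] at h1
    by_contra! hlt
    nlinarith [norm_nonneg X]
  have hint : Integrable (fun ω => ‖h ω‖) P := by
    refine (integrable_const R).mono' hh.norm.aestronglyMeasurable ?_
    filter_upwards [hball] with ω hω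
    rw [norm_norm]
    exact hnorm _ hω
  refine ⟨hint, ?_⟩
  set c := √(2 / Real.pi) with hc
  have hc0 : 0 < c := by positivity
  set S := ∑ d, √(n d : ℝ) with hS
  set μ := Measure.pi fun _ : Fin m => stdGaussian (RealTensor n) with hμ
  have hm0 : (0 : ℝ) < m := by exact_mod_cast hm
  set T : Set (RealTensor n) := {X | ∀ Y, inner ℝ X Y ≤ R * spectralNorm Y} with hT
  have hTb : Bornology.IsBounded T :=
    (Metric.isBounded_closedBall (x := (0 : RealTensor n)) (r := R)).subset fun X hX => by
      simpa using hnorm X hX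
  have hT0 : (0 : RealTensor n) ∈ T := fun Y => by
    rw [inner_zero_left]
    exact mul_nonneg hR (spectralNorm_nonneg hD hn Y)
  have hnormi : ∀ k, Integrable (fun a : Fin m → RealTensor n => ‖a k‖) μ := fun k =>
    (measurePreserving_eval (fun _ : Fin m => stdGaussian (RealTensor n)) k
      ).integrable_comp_of_integrable integrable_norm_stdGaussian
  set N := ∫ a : Fin m → RealTensor n, (m * c + ∑ k, ‖a k‖) ∂μ with hN
  have hNi : Integrable (fun a : Fin m → RealTensor n => m * c + ∑ k, ‖a k‖) μ :=
    (integrable_const _).add (integrable_finsetSum _ fun k _ => hnormi k)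
  have hN0 : 0 ≤ N := integral_nonneg fun a => by positivity
  have key : ∀ ε : ℝ, 0 < ε → m * c * ∫ ω, ‖h ω‖ ∂P ≤ 2 * R * (√(m : ℝ) * S) + ε * N := by
    intro ε hε
    obtain ⟨F, hFT, hF, hFne, hcov⟩ := exists_finite_net hTb ⟨0, hT0⟩ hε
    have := hF.to_subtype
    have := hFne.to_subtype
    set f : (Fin m → RealTensor n) → ℝ := fun a =>
      ⨆ u : F, (0 + ∑ k, (c * ‖(u : RealTensor n)‖ - |inner ℝ (a k) (u : RealTensor n)|)) with hf
    have hfi : Integrable f μ := integrable_iSup_finite fun u => (integrable_const _).add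
      (integrable_finsetSum _ fun k _ => (integrable_const _).sub
        (integrable_inner_eval_pi_stdGaussian k _).abs)
    -- On the kernel the subtracted terms vanish at `h ω`; replacing `h ω` by a net point costs `ε
    -- (c + ‖G ω k‖)` for each `k`.
    have hpt : ∀ᵐ ω ∂P, m * c * ‖h ω‖ ≤ f (G ω) + ε * (m * c + ∑ k, ‖G ω k‖) := by
      filter_upwards [hker, hball] with ω h0 hω
      obtain ⟨u, hu, hdist⟩ := hcov (h ω) hω
      rw [dist_eq_norm] at hdist
      have h1 : ∑ k, (c * ‖u‖ - |inner ℝ (G ω k) u|) ≤ f (G ω) := by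
        have := le_ciSup (f := fun u : F => (0 + ∑ k, (c * ‖(u : RealTensor n)‖ -
          |inner ℝ (G ω k) (u : RealTensor n)|))) (Set.finite_range _).bddAbove ⟨u, hu⟩
        simpa only [hf, zero_add] using this
      have h2 : ∀ k, c * ‖h ω‖ ≤ (c * ‖u‖ - |inner ℝ (G ω k) u|) + ε * (c + ‖G ω k‖) := by
        intro k
        have e1 : ‖h ω‖ ≤ ‖u‖ + ε := by linarith [norm_sub_norm_le (h ω) u]
        have e2 : |inner ℝ (G ω k) u| ≤ ‖G ω k‖ * ε := by
          have : inner ℝ (G ω k) u = -inner ℝ (G ω k) (h ω - u) := by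
            rw [inner_sub_right, h0 k]
            ring
          rw [this, abs_neg]
          exact (abs_real_inner_le_norm _ _).trans
            (mul_le_mul_of_nonneg_left hdist (norm_nonneg _))
        nlinarith [mul_le_mul_of_nonneg_left e1 hc0.le]
      have h3 := Finset.sum_le_sum fun k (_ : k ∈ Finset.univ) => h2 k
      rw [Finset.sum_add_distrib, ← Finset.mul_sum, ← Finset.mul_sum, Finset.sum_add_distrib] at h3
      simp only [Finset.sum_const, Finset.card_univ, Fintype.card_fin, nsmul_eq_mul] at h3
      linarith
    have hbound : Integrable (fun a : Fin m → RealTensor n =>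
        f a + ε * (m * c + ∑ k, ‖a k‖)) μ := hfi.add (hNi.const_mul ε)
    have h4 : m * c * ∫ ω, ‖h ω‖ ∂P ≤
        ∫ a : Fin m → RealTensor n, (f a + ε * (m * c + ∑ k, ‖a k‖)) ∂μ := by
      rw [← integral_const_mul, ← hG.integral_comp hbound.aestronglyMeasurable]
      exact integral_mono_ae (hint.const_mul _)
        ((hG.map_eq ▸ hbound).comp_aemeasurable hG.aemeasurable) hpt
    refine h4.trans ?_
    rw [integral_add hfi (hNi.const_mul ε), integral_const_mul]
    refine add_le_add ((integral_iSup_sum_sub_abs_inner_le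
      (fun u : F => (u : RealTensor n)) m fun _ => 0).trans ?_) le_rfl
    refine le_trans ?_ (mul_le_mul_of_nonneg_left (integral_spectralNorm_sum_pi_le hD hn m)
      (by positivity))
    rw [← integral_const_mul]
    refine integral_mono (integrable_iSup_finite fun u => (integrable_const _).add ?_)
      ((integrable_spectralNorm_sum_pi hD hn m).const_mul _) fun a => ciSup_le fun u => ?_
    · simp_rw [sum_inner]
      exact (integrable_finsetSum _ fun k _ =>
        integrable_inner_eval_pi_stdGaussian k _).const_mul 2
    -- Net points lie in `T`, so the pairing is at most `R` times the spectral norm of the sum.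
    · have := hFT u.2 (∑ k, a k)
      rw [real_inner_comm] at this
      linarith
  have hlim : m * c * ∫ ω, ‖h ω‖ ∂P ≤ 2 * R * (√(m : ℝ) * S) := by
    refine le_of_forall_pos_le_add fun δ hδ => ?_
    refine (key (δ / (N + 1)) (by positivity)).trans (add_le_add le_rfl ?_)
    rw [div_mul_eq_mul_div, div_le_iff₀ (by positivity)]
    nlinarith
  -- The constant `√(2π)` of the statement is `2 / c`: the symmetrization factor over the Gaussian
  -- absolute moment.
  have hcπ : c * √(2 * Real.pi) = 2 := by
    rw [hc, ← Real.sqrt_mul (by positivity)]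
    have : 2 / Real.pi * (2 * Real.pi) = 2 ^ 2 := by
      field_simp
    rw [this, Real.sqrt_sq (by norm_num)]
  have hfin : √(2 * Real.pi) * R * (S / √(m : ℝ)) * (m * c) = 2 * R * (√(m : ℝ) * S) := by
    calc _ = (c * √(2 * Real.pi)) * R * S * (m / √(m : ℝ)) := by ring
      _ = _ := by
        rw [hcπ, Real.div_sqrt]
        ring
  refine le_of_mul_le_mul_right ?_ (mul_pos hm0 hc0)
  rw [hfin, mul_comm]
  exact hlim

theorem IsStdGaussian.hasLaw {Ω : Type*} [MeasurableSpace Ω] {P : Measure Ω}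
    [IsProbabilityMeasure P] {G : Ω → RealTensor n} (hG : IsStdGaussian G P) :
    HasLaw G (stdGaussian (RealTensor n)) P := by
  have hm : ∀ j, AEMeasurable (fun ω => G ω j) P := fun j => (hG.hasLaw_entry j).aemeasurable
  have hm' : AEMeasurable (fun ω => (G ω).ofLp) P := aemeasurable_pi_lambda _ hm
  have hlp : Measurable (WithLp.toLp 2 : (((d : Fin D) → Fin (n d)) → ℝ) → RealTensor n) := by
    fun_prop
  have hGe : G = fun ω => WithLp.toLp 2 (G ω).ofLp := rfl
  refine ⟨hlp.comp_aemeasurable hm', ?_⟩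
  have h := (iIndepFun_iff_map_fun_eq_pi_map hm).1 hG.indep_entries
  simp_rw [(hG.hasLaw_entry _).map_eq] at h
  rw [← map_pi_eq_stdGaussian, ← h, AEMeasurable.map_map_of_aemeasurable hlp.aemeasurable hm']
  rfl

end RealTensor

theorem mainTheorem1 {D : ℕ} (hD : 0 < D) (n : Fin D → ℕ) (hn : ∀ d, 0 < n d)
    {m : ℕ} (hm : 0 < m)
    {Ω : Type*} [MeasurableSpace Ω] (P : Measure Ω) [IsProbabilityMeasure P]
    (G : Fin m → Ω → RealTensor n)
    (hGauss : ∀ i, RealTensor.IsStdGaussian (G i) P)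
    (hIndep : iIndepFun G P)
    (Xsharp : RealTensor n)
    (y : Fin m → Ω → ℝ) (hy : ∀ i ω, y i ω = inner ℝ (G i ω) Xsharp)
    (Xhat : Ω → RealTensor n) (hXhat_meas : AEMeasurable Xhat P)
    (hXhat : ∀ᵐ ω ∂P,
      RealTensor.IsNuclearNormSolution (fun i => G i ω) (fun i => y i ω) (Xhat ω)) :
    Integrable (fun ω => ‖Xhat ω - Xsharp‖) P ∧
      ∫ ω, ‖Xhat ω - Xsharp‖ ∂P ≤
        4 * √Real.pi * ((∑ d, √(n d : ℝ)) / √(m : ℝ)) * RealTensor.nuclearNorm Xsharp := by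
  have hR := RealTensor.nuclearNorm_nonneg hD hn Xsharp
  have hGm : ∀ i, AEMeasurable (G i) P := fun i => (hGauss i).hasLaw.aemeasurable
  have hlaw : HasLaw (fun ω i => G i ω)
      (Measure.pi fun _ : Fin m => stdGaussian (RealTensor n)) P := by
    refine ⟨aemeasurable_pi_lambda _ hGm, ?_⟩
    rw [(iIndepFun_iff_map_fun_eq_pi_map hGm).1 hIndep]
    simp_rw [(hGauss _).hasLaw.map_eq]
  have h := RealTensor.integral_norm_le_of_inner_eq_zero hD hn hm hlaw
    (hXhat_meas.sub_const Xsharp) (R := 2 * RealTensor.nuclearNorm Xsharp) (by positivity)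
    (by
      filter_upwards [hXhat] with ω hω i
      rw [inner_sub_right, hω.1 i, sub_eq_zero]
      exact hy i ω)
    (by
      filter_upwards [hXhat] with ω hω Y
      exact RealTensor.inner_sub_le_of_nuclearNorm_le hD hn
        (hω.2 Xsharp fun i => (hy i ω).symm) Y)
  refine ⟨h.1, h.2.trans ?_⟩
  -- With `R = 2‖Xsharp‖_*` the estimate has constant `2√(2π)`; rounding `√2` up to `2` gives `4√π`.
  have h2 : √(2 * Real.pi) ≤ 2 * √Real.pi := by
    rw [Real.sqrt_mul (by norm_num)]
    exact mul_le_mul_of_nonneg_right (Real.sqrt_le_iff.2 ⟨by norm_num, by norm_num⟩)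
      (Real.sqrt_nonneg _)
  have h3 : 0 ≤ (∑ d, √(n d : ℝ)) / √(m : ℝ) * RealTensor.nuclearNorm Xsharp := by positivity
  nlinarith [mul_le_mul_of_nonneg_right h2 h3]
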